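/- Let $$H=\{(x_1,x_2,x_3)\in\mathbb R^3:\ x_1,x_2\in(0,1),\ 0<x_3<\min\{x_1x_2,(1-x_1)(1-x_2)\}\}$$ and, for $i=1,2$, let $\psi_i:H\to(0,1)^3$ be the bijection $$\psi_i(x_1,x_2,x_3)=\left(x_i,\ \frac{x_1x_2-x_3}{x_i},\ \frac{x_3}{(1-x_i)(x_i-x_1x_2+x_3)}\right).$$ Let $\Psi=\psi_2\circ\psi_1^{-1}:(0,1)^3\to(0,1)^3$; explicitly, $$\Psi(y_1,y_2,y_3)=\left(y_2+(1-y_1)(1-y_2)y_3,\ \frac{y_1y_2}{y_2+(1-y_1)(1-y_2)y_3},\ \frac{y_1y_3}{[1-(1-y_1)y_3]\,[y_2+y_3(1-y_2)]}\right).$$ For $a,b>0$ let $B_I(a,b)$ denote the beta distribution on $(0,1)$, with density proportional to $x^{a-1}(1-x)^{b-1}$ on $(0,1)$. **Theorem.** Let $\mathbf Y=(Y_1,Y_2,Y_3)$ be a $(0,1)^3$-valued random vector with independent components whose distribution has a density that is strictly positive and continuously differentiable on $(0,1)^3$. Suppose that $\mathbf Z=(Z_1,Z_2,Z_3)=\Psi(\mathbf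 Y)$ also has independent components. Then there exist real numbers $p,q,r>0$ such that $\mathbf Y$ and $\mathbf Z$ have the same distribution, namely $$B_I(p+r,q+r)\otimes B_I(p,q+r)\otimes B_I(r,q).$$ -/

import Mathlib

open MeasureTheory ProbabilityTheory

namespace BetaIndependence

/-- The open unit cube `(0, 1)³`. -/
def cube : Set (Fin 3 → ℝ) := {y | ∀ i, y i ∈ Set.Ioo (0 : ℝ) 1}

/-- The domain `H` of the points `(x₁, x₂, x₃)` with `x₁, x₂ ∈ (0, 1)` and
`0 < x₃ < min {x₁ x₂, (1 - x₁) (1 - x₂)}`. -/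
def H : Set (Fin 3 → ℝ) :=
  {x | x 0 ∈ Set.Ioo (0 : ℝ) 1 ∧ x 1 ∈ Set.Ioo (0 : ℝ) 1 ∧ 0 < x 2 ∧
    x 2 < min (x 0 * x 1) ((1 - x 0) * (1 - x 1))}

/-- The map `ψ₁`. -/
noncomputable def psi1 (x : Fin 3 → ℝ) : Fin 3 → ℝ :=
  ![x 0, (x 0 * x 1 - x 2) / x 0, x 2 / ((1 - x 0) * (x 0 - x 0 * x 1 + x 2))]

/-- The map `ψ₂`. -/
noncomputable def psi2 (x : Fin 3 → ℝ) : Fin 3 → ℝ :=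
  ![x 1, (x 0 * x 1 - x 2) / x 1, x 2 / ((1 - x 1) * (x 1 - x 0 * x 1 + x 2))]

/-- The map `Ψ = ψ₂ ∘ ψ₁⁻¹`, where `ψ₁⁻¹ : (0, 1)³ → H` is the inverse of the bijection
`ψ₁ : H → (0, 1)³`. Only its values on the cube are meaningful. -/
noncomputable def Psi : (Fin 3 → ℝ) → (Fin 3 → ℝ) :=
  psi2 ∘ Function.invFunOn psi1 H

/-- `ψ₁` is a bijection of `H` onto the cube. -/
theorem psi1_bijOn : Set.BijOn psi1 H cube := by
  refine ⟨?_, ?_, ?_⟩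
  · rintro x ⟨⟨h0, h0'⟩, ⟨h1, h1'⟩, h2, h3⟩
    obtain ⟨h3, h4⟩ := lt_min_iff.1 h3
    have a1 : 0 < 1 - x 0 := by linarith
    have a2 : 0 < x 0 - x 0 * x 1 + x 2 := by nlinarith
    intro i
    fin_cases i
    · exact ⟨h0, h0'⟩
    · refine ⟨div_pos (by linarith) h0, (div_lt_one h0).2 (by nlinarith)⟩
    · refine ⟨div_pos h2 (mul_pos a1 a2), (div_lt_one (mul_pos a1 a2)).2 (by nlinarith)⟩
  · rintro x ⟨⟨h0, h0'⟩, ⟨h1, h1'⟩, h2, h3⟩ y ⟨⟨k0, k0'⟩, ⟨k1, k1'⟩, k2, k3⟩ hxy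
    have e0 : x 0 = y 0 := congrFun hxy 0
    have e1 : (x 0 * x 1 - x 2) / x 0 = (y 0 * y 1 - y 2) / y 0 := congrFun hxy 1
    have e2 : x 2 / ((1 - x 0) * (x 0 - x 0 * x 1 + x 2)) =
      y 2 / ((1 - y 0) * (y 0 - y 0 * y 1 + y 2)) := congrFun hxy 2
    rw [e0] at e1 e2
    have f1 : y 0 * x 1 - x 2 = y 0 * y 1 - y 2 := (div_left_inj' k0.ne').1 e1
    have f2 : y 0 - y 0 * x 1 + x 2 = y 0 - y 0 * y 1 + y 2 := by linarith
    rw [f2] at e2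
    have a : 0 < (1 - y 0) * (y 0 - y 0 * y 1 + y 2) :=
      mul_pos (by linarith) (by nlinarith)
    have f3 : x 2 = y 2 := (div_left_inj' a.ne').1 e2
    have f4 : x 1 = y 1 := by
      have : y 0 * x 1 = y 0 * y 1 := by linarith
      exact mul_left_cancel₀ k0.ne' this
    funext i
    fin_cases i
    · exact e0
    · exact f4
    · exact f3
  · intro y hy
    obtain ⟨h0, h0'⟩ := hy 0
    obtain ⟨h1, h1'⟩ := hy 1
    obtain ⟨h2, h2'⟩ := hy 2
    have a0 : 0 < 1 - y 0 := by linarith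
    have a1 : 0 < 1 - y 1 := by linarith
    have a2 : 0 < 1 - y 2 := by linarith
    have b := mul_pos (mul_pos a0 a1) h2
    have b' := mul_pos (mul_pos a0 a1) a2
    have c := mul_pos h0 a1
    refine ⟨![y 0, y 1 + (1 - y 0) * (1 - y 1) * y 2, y 0 * (1 - y 0) * (1 - y 1) * y 2],
      ⟨⟨h0, h0'⟩, ⟨?_, ?_⟩, ?_, ?_⟩, ?_⟩
    · change 0 < y 1 + (1 - y 0) * (1 - y 1) * y 2
      linarith
    · change y 1 + (1 - y 0) * (1 - y 1) * y 2 < 1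
      nlinarith
    · change 0 < y 0 * (1 - y 0) * (1 - y 1) * y 2
      positivity
    · change y 0 * (1 - y 0) * (1 - y 1) * y 2 < min (y 0 * (y 1 + (1 - y 0) * (1 - y 1) * y 2))
        ((1 - y 0) * (1 - (y 1 + (1 - y 0) * (1 - y 1) * y 2)))
      refine lt_min ?_ ?_
      · nlinarith [mul_pos h0 h1]
      · nlinarith
    · funext i
      fin_cases i
      · rfl
      · change (y 0 * (y 1 + (1 - y 0) * (1 - y 1) * y 2) - y 0 * (1 - y 0) * (1 - y 1) * y 2) / y 0
          = y 1
        field_simp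
        ring
      · change y 0 * (1 - y 0) * (1 - y 1) * y 2 / ((1 - y 0) *
          (y 0 - y 0 * (y 1 + (1 - y 0) * (1 - y 1) * y 2) + y 0 * (1 - y 0) * (1 - y 1) * y 2))
          = y 2
        have : (1 - y 0) *
          (y 0 - y 0 * (y 1 + (1 - y 0) * (1 - y 1) * y 2) + y 0 * (1 - y 0) * (1 - y 1) * y 2)
          = y 0 * (1 - y 0) * (1 - y 1) := by ring
        rw [this]
        field_simp

/-- The explicit form of `Ψ` on the cube. -/
theorem Psi_apply {y : Fin 3 → ℝ} (hy : y ∈ cube) :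
    Psi y = ![y 1 + (1 - y 0) * (1 - y 1) * y 2,
      y 0 * y 1 / (y 1 + (1 - y 0) * (1 - y 1) * y 2),
      y 0 * y 2 / ((1 - (1 - y 0) * y 2) * (y 1 + y 2 * (1 - y 1)))] := by
  have hmem : Function.invFunOn psi1 H y ∈ H := Function.invFunOn_mem (psi1_bijOn.surjOn hy)
  have heq : psi1 (Function.invFunOn psi1 H y) = y := Function.invFunOn_eq (psi1_bijOn.surjOn hy)
  change psi2 (Function.invFunOn psi1 H y) = _
  generalize Function.invFunOn psi1 H y = x at hmem heq
  obtain ⟨⟨h0, h0'⟩, ⟨h1, h1'⟩, h2, h3⟩ := hmem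
  obtain ⟨k0, k0'⟩ := hy 0
  obtain ⟨k1, k1'⟩ := hy 1
  obtain ⟨k2, k2'⟩ := hy 2
  have a0 : 0 < 1 - y 0 := by linarith
  have a1 : 0 < 1 - y 1 := by linarith
  have e0 : x 0 = y 0 := congrFun heq 0
  have e1 : (x 0 * x 1 - x 2) / x 0 = y 1 := congrFun heq 1
  have e2 : x 2 / ((1 - x 0) * (x 0 - x 0 * x 1 + x 2)) = y 2 := congrFun heq 2
  rw [e0] at e1 e2
  rw [div_eq_iff k0.ne'] at e1
  have f : y 0 - y 0 * x 1 + x 2 = y 0 * (1 - y 1) := by linarith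
  rw [f, div_eq_iff (by positivity)] at e2
  have f1 : x 1 = y 1 + (1 - y 0) * (1 - y 1) * y 2 := by
    refine mul_left_cancel₀ k0.ne' ?_
    linarith
  have g1 : 0 < 1 - (1 - y 0) * y 2 := by nlinarith
  have g2 : 0 < y 1 + y 2 * (1 - y 1) := by positivity
  funext i
  fin_cases i
  · exact f1
  · change (x 0 * x 1 - x 2) / x 1 = y 0 * y 1 / (y 1 + (1 - y 0) * (1 - y 1) * y 2)
    rw [e0, e1, ← f1, mul_comm (y 1)]
  · change x 2 / ((1 - x 1) * (x 1 - x 0 * x 1 + x 2)) =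
      y 0 * y 2 / ((1 - (1 - y 0) * y 2) * (y 1 + y 2 * (1 - y 1)))
    have g3 : (1 - x 1) * (x 1 - x 0 * x 1 + x 2) = ((1 - y 0) * (1 - y 1)) *
        ((1 - (1 - y 0) * y 2) * (y 1 + y 2 * (1 - y 1))) := by
      rw [e0, e2, f1]; ring
    rw [g3, e2]
    field_simp

/-- The product law `B_I(p + r, q + r) ⊗ B_I(p, q + r) ⊗ B_I(r, q)`. -/
noncomputable def betaProduct (p q r : ℝ) : Measure (Fin 3 → ℝ) :=
  Measure.pi ![betaMeasure (p + r) (q + r), betaMeasure p (q + r), betaMeasure r q]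

end BetaIndependence

/-!
In the coordinates `x = x₁`, `y = x₂`, `w = x₁ x₂ - x₃` of `H`, the first two coordinates of `ψ₁`
are `x` and `w / x`, and the odds of the third one are `t / x` with `t = x₃ / (1 - x - y + w)`;
for `ψ₂` replace `x` by `y`. Exchanging `x` and `y` shows that `Ψ` is an involution, and its Jacobian
is `(1 - y) (y - w) / ((1 - x) (x - w))` (`psiFormula_mem_and_involutive`,
`map_psiFormula_withDensity`). Continuity turns independence into a pointwise factorization of the
densities of `Y` and `Z` (`exists_slices`), so the logarithms satisfy
`a₁ x + a₂ (w / x) + a₃ (t / x) = b₁ y + b₂ (w / y) + b₃ (t / y)` (`AdditiveEquation`).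

Put `u = w / x`, `l = y / x`, `o = t / x`; these are three free parameters. Differentiating in `w`
removes `a₁` and `b₁`, and the result separates: with `α₂ u = u a₂' u` and similarly `α₃, β₂, β₃`,
`(α₂ u - β₂ (u / l)) (l - u) (1 - u) / u = (α₃ o - β₃ (o / l)) (1 + o) (l + o) / o`,
so that both sides depend on `l` only (`AdditiveEquation.separated`). The right-hand side says that
`α₃ o - β₃ o'` is a function `d` of `o / o'` times `1 / (1 + o') - 1 / (1 + o)`. The cocycle identity
for the left-hand side forces `d` to be constant (`eq_const_sub_div_of_sub_eq`), which determines
`α₃ = β₃` and then `α₂ = β₂`. Integrating, and returning to the additive equation for `a₁` and `b₁`,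
yields beta densities with matching exponents for both vectors (`exists_beta_form`); since the
densities are integrable the parameters are positive, and the constants are the normalizing ones
(`eq_pi_betaMeasure`).
-/

namespace BetaIndependence

/-! ### The additive functional equation -/

/-- For `x ∈ H` and `w = x₁ x₂ - x₃`, the quantity `x₃ / (1 - x₁ - x₂ + w)`, as a function of
`x = x₁`, `y = x₂` and `w`. The odds of the last coordinates of `ψ₁ x` and `ψ₂ x` are
`oddsRatio x y w / x` and `oddsRatio x y w / y`. -/
noncomputable def oddsRatio (x y w : ℝ) : ℝ := (x * y - w) / (1 - x - y + w)

/-- The additive form of the identity between two product densities related by `Ψ`: the six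
functions are logarithms of (slightly modified) one-dimensional densities, with those of the last
coordinates taken as functions of the odds. -/
def AdditiveEquation (a₁ a₂ a₃ b₁ b₂ b₃ : ℝ → ℝ) : Prop :=
  ∀ x ∈ Set.Ioo (0 : ℝ) 1, ∀ y ∈ Set.Ioo (0 : ℝ) 1, ∀ w, 0 < w → x + y - 1 < w → w < x * y →
    a₁ x + a₂ (w / x) + a₃ (oddsRatio x y w / x) =
      b₁ y + b₂ (w / y) + b₃ (oddsRatio x y w / y)

theorem hasDerivAt_oddsRatio {x y w : ℝ} (h : 1 - x - y + w ≠ 0) :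
    HasDerivAt (oddsRatio x y) (-((1 - x) * (1 - y)) / (1 - x - y + w) ^ 2) w := by
  have h1 : HasDerivAt (fun w => x * y - w) (-1) w := by
    simpa using (hasDerivAt_id w).const_sub (x * y)
  have h2 : HasDerivAt (fun w => 1 - x - y + w) 1 w := by
    simpa using (hasDerivAt_id w).const_add (1 - x - y)
  refine (h1.div h2 h).congr_deriv ?_
  congr 1
  ring

/-- Any `u`, `l`, `o` with `u < min 1 l` are realized as `u = w / x`, `l = y / x` and
`o = oddsRatio x y w / x` at a point of the domain of `AdditiveEquation`. -/
theorem exists_coordinates {u l o : ℝ} (hu : 0 < u) (hu1 : u < 1) (hul : u < l) (ho : 0 < o) :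
    ∃ x ∈ Set.Ioo (0 : ℝ) 1, l * x ∈ Set.Ioo (0 : ℝ) 1 ∧ 0 < u * x ∧ x + l * x - 1 < u * x ∧
      u * x < x * (l * x) ∧ oddsRatio x (l * x) (u * x) = o * x ∧
      (1 - x) * (1 - l * x) = (1 - x - l * x + u * x) * (1 + o * x) ∧
      (1 - x - l * x + u * x) * (l + o * (1 + l - u)) = (l - u) * (1 - u) ∧
      (1 + o * x) * (l + o * (1 + l - u)) = (1 + o) * (l + o) := by
  have hl : 0 < l := hu.trans hul
  have hN : 0 < l + o * (1 + l - u) := by nlinarith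
  obtain ⟨x, hx⟩ : ∃ x, x = (o + u) / (l + o * (1 + l - u)) := ⟨_, rfl⟩
  have hxN : x * (l + o * (1 + l - u)) = o + u := by rw [hx, div_mul_cancel₀ _ hN.ne']
  have hx0 : 0 < x := by rw [hx]; positivity
  have hx1 : x < 1 := by rw [hx, div_lt_one hN]; nlinarith
  have hy1 : l * x < 1 := by
    rw [hx, ← mul_div_assoc, div_lt_one hN]; nlinarith
  have hsN : (1 - x - l * x + u * x) * (l + o * (1 + l - u)) = (l - u) * (1 - u) := by
    linear_combination (-(1 + l - u)) * hxN
  have hs : 0 < 1 - x - l * x + u * x := by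
    have : 0 < (1 - x - l * x + u * x) * (l + o * (1 + l - u)) := by
      rw [hsN]; exact mul_pos (by linarith) (by linarith)
    exact pos_of_mul_pos_left this hN.le
  have hm : x * (l * x) - u * x = o * x * (1 - x - l * x + u * x) := by
    linear_combination x * hxN
  refine ⟨x, ⟨hx0, hx1⟩, ⟨by positivity, hy1⟩, by positivity, by linarith, ?_, ?_, ?_, hsN, ?_⟩
  · have : 0 < o * x * (1 - x - l * x + u * x) := by positivity
    linarith
  · rw [oddsRatio, hm, mul_div_cancel_right₀ _ hs.ne']
  · linear_combination hm
  · linear_combination o * hxN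

variable {a₁ a₂ a₃ b₁ b₂ b₃ : ℝ → ℝ}

/-- Differentiating the additive equation in `w` eliminates `a₁` and `b₁`; in the coordinates
`u = w / x`, `l = y / x`, `o = oddsRatio x y w / x` the variables `u` and `o` then separate for each
fixed `l`. -/
theorem AdditiveEquation.separated (h : AdditiveEquation a₁ a₂ a₃ b₁ b₂ b₃)
    (ha₂ : ∀ u ∈ Set.Ioo (0 : ℝ) 1, DifferentiableAt ℝ a₂ u)
    (hb₂ : ∀ u ∈ Set.Ioo (0 : ℝ) 1, DifferentiableAt ℝ b₂ u)
    (ha₃ : ∀ o, 0 < o → DifferentiableAt ℝ a₃ o) (hb₃ : ∀ o, 0 < o → DifferentiableAt ℝ b₃ o)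
    {u l o : ℝ} (hu : 0 < u) (hu1 : u < 1) (hul : u < l) (ho : 0 < o) :
    (u * deriv a₂ u - u / l * deriv b₂ (u / l)) * ((l - u) * (1 - u) / u) =
      (o * deriv a₃ o - o / l * deriv b₃ (o / l)) * ((1 + o) * (l + o) / o) := by
  obtain ⟨x, hx, hy, hw0, hw1, hw2, ht, hK, hsN, htN⟩ := exists_coordinates hu hu1 hul ho
  have hl : 0 < l := hu.trans hul
  have hx0 := hx.1
  have hs : 0 < 1 - x - l * x + u * x := by linarith
  have hN : 0 < l + o * (1 + l - u) := by nlinarith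
  have e1 : u * x / x = u := by field_simp
  have e2 : u * x / (l * x) = u / l := by field_simp
  have e3 : oddsRatio x (l * x) (u * x) / x = o := by rw [ht]; field_simp
  have e4 : oddsRatio x (l * x) (u * x) / (l * x) = o / l := by rw [ht]; field_simp
  have hul' : u / l ∈ Set.Ioo (0 : ℝ) 1 := ⟨by positivity, (div_lt_one hl).2 hul⟩
  have dt := hasDerivAt_oddsRatio hs.ne'
  have d2 : HasDerivAt (fun w => a₂ (w / x)) (deriv a₂ u * (1 / x)) (u * x) :=
    HasDerivAt.comp (u * x) (by rw [e1]; exact (ha₂ u ⟨hu, hu1⟩).hasDerivAt)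
      ((hasDerivAt_id _).div_const x)
  have d2' : HasDerivAt (fun w => b₂ (w / (l * x))) (deriv b₂ (u / l) * (1 / (l * x))) (u * x) :=
    HasDerivAt.comp (u * x) (by rw [e2]; exact (hb₂ _ hul').hasDerivAt)
      ((hasDerivAt_id _).div_const (l * x))
  have d3 : HasDerivAt (fun w => a₃ (oddsRatio x (l * x) w / x)) _ (u * x) :=
    HasDerivAt.comp (h₂ := a₃) (h₂' := deriv a₃ o) (u * x)
      (by rw [e3]; exact (ha₃ o ho).hasDerivAt) (dt.div_const x)
  have d3' : HasDerivAt (fun w => b₃ (oddsRatio x (l * x) w / (l * x))) _ (u * x) :=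
    HasDerivAt.comp (h₂ := b₃) (h₂' := deriv b₃ (o / l)) (u * x)
      (by rw [e4]; exact (hb₃ _ (by positivity)).hasDerivAt) (dt.div_const (l * x))
  have d0 := ((d2.add d3).sub (d2'.add d3')).congr_of_eventuallyEq
    (f₁ := fun _ => b₁ (l * x) - a₁ x) (by
      filter_upwards [lt_mem_nhds hw0, lt_mem_nhds hw1, gt_mem_nhds hw2] with w h0 h1 h2
      have := h x hx (l * x) hy w h0 h1 h2
      simp only [Pi.add_apply, Pi.sub_apply]
      linarith)
  have key := d0.unique (hasDerivAt_const _ _)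
  rw [hK] at key
  generalize deriv a₂ u = A at *
  generalize deriv b₂ (u / l) = B at *
  generalize deriv a₃ o = C at *
  generalize deriv b₃ (o / l) = D at *
  have k1 : (A - B / l) * (1 - x - l * x + u * x) = (C - D / l) * (1 + o * x) := by
    generalize 1 - x - l * x + u * x = s at *
    field_simp at key ⊢
    linear_combination key
  have k2 : (A - B / l) * ((l - u) * (1 - u)) = (C - D / l) * ((1 + o) * (l + o)) := by
    rw [← hsN, ← htN]
    linear_combination (l + o * (1 + l - u)) * k1
  have e5 : (u * A - u / l * B) * ((l - u) * (1 - u) / u) =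
      (A - B / l) * ((l - u) * (1 - u)) := by field_simp
  have e6 : (o * C - o / l * D) * ((1 + o) * (l + o) / o) =
      (C - D / l) * ((1 + o) * (l + o)) := by field_simp
  rw [e5, e6, k2]

/-- If `α - β` is proportional to `1 / (1 + o') - 1 / (1 + o)` with a factor that may depend on
the quotient `o / o'`, then the factor is constant and both functions are affine in `1 / (1 + o)`.
The cocycle identity for four differences `α (o) - β (o')` along a scaled configuration becomes a
rational identity in the scale, whose value at `-1` compares two values of the factor. -/
theorem eq_const_sub_div_of_sub_eq {α β d : ℝ → ℝ}
    (h : ∀ o o' : ℝ, 0 < o → 0 < o' → o ≠ o' →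
      α o - β o' = d (o / o') * (1 / (1 + o') - 1 / (1 + o))) :
    ∃ c e : ℝ, (∀ o, 0 < o → α o = c - e / (1 + o)) ∧ (∀ o, 0 < o → β o = c - e / (1 + o)) ∧
      ∀ l, 0 < l → l ≠ 1 → d l = e := by
  have hd : ∀ l m : ℝ, 0 < l → 0 < m → l ≠ 1 → m ≠ 1 → d l = d m := by
    intro l m hl hm hl1 hm1
    -- any `n` different from `1`, `l` and `m` serves as the fourth point
    obtain ⟨n, hn⟩ : ∃ n, n = 1 + l + m := ⟨_, rfl⟩
    have hn0 : 0 < n := by linarith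
    -- a cubic polynomial identity in the scale `s`
    have hpoly : ∀ s : ℝ, 0 < s →
        (d l - d m) * ((1 + l * s) * (1 + m * s) * (1 + n * s)) +
        (d (l / n) - d l) * ((1 + s) * (1 + m * s) * (1 + n * s)) +
        (d m - d (m / n)) * ((1 + s) * (1 + l * s) * (1 + n * s)) +
        (d (m / n) - d (l / n)) * ((1 + s) * (1 + l * s) * (1 + m * s)) = 0 := by
      intro s hs
      have q1 := h (l * s) s (by positivity) hs (fun h => hl1 (by
        exact mul_right_cancel₀ hs.ne' (h.trans (one_mul s).symm)))
      have q2 := h (m * s) s (by positivity) hs (fun h => hm1 (by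
        exact mul_right_cancel₀ hs.ne' (h.trans (one_mul s).symm)))
      have q3 := h (l * s) (n * s) (by positivity) (by positivity) (fun h => by
        have := mul_right_cancel₀ hs.ne' h; linarith)
      have q4 := h (m * s) (n * s) (by positivity) (by positivity) (fun h => by
        have := mul_right_cancel₀ hs.ne' h; linarith)
      rw [mul_div_cancel_right₀ _ hs.ne'] at q1 q2
      rw [mul_div_mul_right _ _ hs.ne'] at q3 q4
      have q := congrArg₂ (· - ·) (congrArg₂ (· - ·) q1 q2) (congrArg₂ (· - ·) q3 q4)
      have q' : d l * (1 / (1 + s) - 1 / (1 + l * s)) - d m * (1 / (1 + s) - 1 / (1 + m * s)) -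
          (d (l / n) * (1 / (1 + n * s) - 1 / (1 + l * s)) -
            d (m / n) * (1 / (1 + n * s) - 1 / (1 + m * s))) = 0 := by
        linear_combination -q
      field_simp at q'
      linear_combination q'
    generalize d (l / n) = A at *
    generalize d (m / n) = B at *
    generalize d l = C at *
    generalize d m = D at *
    have h1 := hpoly 1 one_pos
    have h2 := hpoly 2 two_pos
    have h3 := hpoly 3 three_pos
    have h4 := hpoly 4 four_pos
    -- extrapolation of a cubic polynomial from `1, 2, 3, 4` to `-1`
    have h5 : (C - D) * ((1 - l) * (1 - m) * (1 - n)) = 0 := by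
      linear_combination 10 * h1 - 20 * h2 + 15 * h3 - 4 * h4
    rcases mul_eq_zero.1 h5 with h6 | h6
    · linarith
    · have : (1 - l) * (1 - m) * (1 - n) ≠ 0 :=
        mul_ne_zero (mul_ne_zero (sub_ne_zero.2 (Ne.symm hl1)) (sub_ne_zero.2 (Ne.symm hm1)))
          (by linarith)
      exact absurd h6 this
  obtain ⟨c, hc⟩ : ∃ c, c = α 1 + d 2 / (1 + 1) := ⟨_, rfl⟩
  have hd2 : ∀ o o' : ℝ, 0 < o → 0 < o' → o ≠ o' → d (o / o') = d 2 := fun o o' h0 h0' hne =>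
    hd _ _ (by positivity) two_pos (fun h => hne ((div_eq_one_iff_eq h0'.ne').1 h)) (by norm_num)
  have h' : ∀ o o' : ℝ, 0 < o → 0 < o' → o ≠ o' → α o + d 2 / (1 + o) = β o' + d 2 / (1 + o') := by
    intro o o' h0 h0' hne
    have := h o o' h0 h0' hne
    rw [hd2 o o' h0 h0' hne] at this
    linear_combination this
  have hβ : ∀ o, 0 < o → β o = c - d 2 / (1 + o) := by
    intro o ho
    by_cases h1 : o = 1
    · have q1 := h' 2 o two_pos ho (by rw [h1]; norm_num)
      have q2 := h' 2 3 two_pos three_pos (by norm_num)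
      have q3 := h' 1 3 one_pos three_pos (by norm_num)
      linarith
    · have := h' 1 o one_pos ho (Ne.symm h1)
      linarith
  refine ⟨c, d 2, fun o ho => ?_, hβ, fun l hl hl1 => hd l 2 hl two_pos hl1 (by norm_num)⟩
  have q1 := h' o (o + 1) ho (by positivity) (by linarith)
  rw [hβ (o + 1) (by positivity)] at q1
  linarith

/-- The logarithmic derivatives of the four regular functions in the additive equation. -/
theorem AdditiveEquation.mul_deriv_eq (h : AdditiveEquation a₁ a₂ a₃ b₁ b₂ b₃)
    (ha₂ : ∀ u ∈ Set.Ioo (0 : ℝ) 1, DifferentiableAt ℝ a₂ u)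
    (hb₂ : ∀ u ∈ Set.Ioo (0 : ℝ) 1, DifferentiableAt ℝ b₂ u)
    (ha₃ : ∀ o, 0 < o → DifferentiableAt ℝ a₃ o) (hb₃ : ∀ o, 0 < o → DifferentiableAt ℝ b₃ o) :
    ∃ c c' e : ℝ, (∀ u ∈ Set.Ioo (0 : ℝ) 1, u * deriv a₂ u = c' + e / (1 - u)) ∧
      (∀ u ∈ Set.Ioo (0 : ℝ) 1, u * deriv b₂ u = c' + e / (1 - u)) ∧
      (∀ o, 0 < o → o * deriv a₃ o = c - e / (1 + o)) ∧
      (∀ o, 0 < o → o * deriv b₃ o = c - e / (1 + o)) := by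
  have hsep := fun {u l o : ℝ} hu hu1 hul ho =>
    h.separated (u := u) (l := l) (o := o) ha₂ hb₂ ha₃ hb₃ hu hu1 hul ho
  -- the common value of both sides of the separated equation, evaluated at `o = 1`
  obtain ⟨k, hk⟩ : ∃ k : ℝ → ℝ, ∀ l, k l =
      (1 * deriv a₃ 1 - 1 / l * deriv b₃ (1 / l)) * ((1 + 1) * (l + 1) / 1) := ⟨_, fun _ => rfl⟩
  have hk2 : ∀ u l : ℝ, 0 < u → u < 1 → u < l →
      (u * deriv a₂ u - u / l * deriv b₂ (u / l)) * ((l - u) * (1 - u) / u) = k l := by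
    intro u l hu hu1 hul
    rw [hk, hsep hu hu1 hul one_pos]
  have hk3 : ∀ l o : ℝ, 0 < l → 0 < o →
      (o * deriv a₃ o - o / l * deriv b₃ (o / l)) * ((1 + o) * (l + o) / o) = k l := by
    intro l o hl ho
    obtain ⟨u, hu, hul⟩ := exists_between (lt_min one_pos hl)
    have h1 := hul.trans_le (min_le_left _ _)
    have h2 := hul.trans_le (min_le_right _ _)
    rw [← hsep hu h1 h2 ho, hk2 u l hu h1 h2]
  obtain ⟨c, e, hα, hβ, hd⟩ := eq_const_sub_div_of_sub_eq (α := fun o => o * deriv a₃ o)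
    (β := fun o => o * deriv b₃ o) (d := fun l => k l / (l - 1)) (by
      intro o o' ho ho' hne
      have q := hk3 (o / o') o (by positivity) ho
      have hne' : o - o' ≠ 0 := sub_ne_zero.2 hne
      have e1 : o / (o / o') = o' := by field_simp
      rw [e1] at q
      rw [← q]
      field_simp
      ring)
  have h2 : ∀ u v : ℝ, u ∈ Set.Ioo (0 : ℝ) 1 → v ∈ Set.Ioo (0 : ℝ) 1 → u ≠ v →
      u * deriv a₂ u - e / (1 - u) = v * deriv b₂ v - e / (1 - v) := by
    rintro u v ⟨hu, hu1⟩ ⟨hv, hv1⟩ hne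
    have hlt : u < u / v := by rw [lt_div_iff₀ hv]; nlinarith
    have q := hk2 u (u / v) hu hu1 hlt
    have hne' : u - v ≠ 0 := sub_ne_zero.2 hne
    have q2 := hd (u / v) (by positivity) (fun h => hne ((div_eq_one_iff_eq hv.ne').1 h))
    have e1 : u / (u / v) = v := by field_simp
    have g1 : 1 - u ≠ 0 := by linarith
    have g2 : 1 - v ≠ 0 := by linarith
    rw [e1] at q
    have q3 : k (u / v) = e * (u / v - 1) := by
      rw [← q2, div_mul_cancel₀]
      rw [div_sub_one hv.ne']
      exact div_ne_zero hne' hv.ne'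
    rw [q3] at q
    generalize deriv a₂ u = A at *
    generalize deriv b₂ v = B at *
    have q4 : (u * A - v * B) * ((1 - v) * (1 - u)) = e * (u - v) := by
      field_simp at q
      linear_combination q
    rw [sub_eq_sub_iff_add_eq_add]
    field_simp
    linear_combination q4
  obtain ⟨c', hc'⟩ : ∃ c', c' = 1 / 2 * deriv a₂ (1 / 2) - e / (1 - 1 / 2) := ⟨_, rfl⟩
  have m2 : (1 / 2 : ℝ) ∈ Set.Ioo (0 : ℝ) 1 := by constructor <;> norm_num
  have m3 : (1 / 3 : ℝ) ∈ Set.Ioo (0 : ℝ) 1 := by constructor <;> norm_num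
  have m4 : (1 / 4 : ℝ) ∈ Set.Ioo (0 : ℝ) 1 := by constructor <;> norm_num
  have hb : ∀ u ∈ Set.Ioo (0 : ℝ) 1, u * deriv b₂ u = c' + e / (1 - u) := by
    intro u hu
    by_cases h1 : u = 1 / 2
    · have q1 := h2 (1 / 3) u m3 hu (by rw [h1]; norm_num)
      have q2 := h2 (1 / 3) (1 / 4) m3 m4 (by norm_num)
      have q3 := h2 (1 / 2) (1 / 4) m2 m4 (by norm_num)
      linarith
    · have := h2 (1 / 2) u m2 hu (Ne.symm h1)
      linarith
  refine ⟨c, c', e, fun u hu => ?_, hb, hα, hβ⟩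
  have m5 : u / 2 ∈ Set.Ioo (0 : ℝ) 1 := ⟨by linarith [hu.1], by linarith [hu.2, hu.1]⟩
  have q1 := h2 u (u / 2) hu m5 (by linarith [hu.1])
  rw [hb _ m5] at q1
  linarith

theorem exists_eq_add_log_Ioo {a : ℝ → ℝ} {c e : ℝ}
    (ha : ∀ u ∈ Set.Ioo (0 : ℝ) 1, DifferentiableAt ℝ a u)
    (h : ∀ u ∈ Set.Ioo (0 : ℝ) 1, u * deriv a u = c + e / (1 - u)) :
    ∃ k, ∀ u ∈ Set.Ioo (0 : ℝ) 1, a u = k + (c + e) * Real.log u - e * Real.log (1 - u) := by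
  have hd : ∀ u ∈ Set.Ioo (0 : ℝ) 1,
      HasDerivAt (fun u => (c + e) * Real.log u - e * Real.log (1 - u)) (deriv a u) u := by
    rintro u ⟨hu, hu1⟩
    have g : 1 - u ≠ 0 := by linarith
    have h1 := ((Real.hasDerivAt_log hu.ne').const_mul (c + e)).sub
      ((((hasDerivAt_id u).const_sub 1).log g).const_mul e)
    refine h1.congr_deriv ?_
    have := h u ⟨hu, hu1⟩
    simp only [id]
    field_simp at this ⊢
    linear_combination -this
  obtain ⟨k, hk⟩ := isOpen_Ioo.exists_eq_add_of_deriv_eq isPreconnected_Ioo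
    (fun u hu => (ha u hu).differentiableWithinAt)
    (fun u hu => (hd u hu).differentiableAt.differentiableWithinAt)
    (fun u hu => (hd u hu).deriv.symm)
  exact ⟨k, fun u hu => by have := hk hu; simp only at this; linarith⟩

theorem exists_eq_add_log_Ioi {a : ℝ → ℝ} {c e : ℝ}
    (ha : ∀ o, 0 < o → DifferentiableAt ℝ a o)
    (h : ∀ o, 0 < o → o * deriv a o = c - e / (1 + o)) :
    ∃ k, ∀ o, 0 < o → a o = k + (c - e) * Real.log o + e * Real.log (1 + o) := by
  have hd : ∀ o ∈ Set.Ioi (0 : ℝ),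
      HasDerivAt (fun o => (c - e) * Real.log o + e * Real.log (1 + o)) (deriv a o) o := by
    rintro o (ho : 0 < o)
    have g : 1 + o ≠ 0 := by linarith
    have h1 := ((Real.hasDerivAt_log ho.ne').const_mul (c - e)).add
      ((((hasDerivAt_id o).const_add 1).log g).const_mul e)
    refine h1.congr_deriv ?_
    have := h o ho
    simp only [id]
    field_simp at this ⊢
    linear_combination -this
  obtain ⟨k, hk⟩ := isOpen_Ioi.exists_eq_add_of_deriv_eq isPreconnected_Ioi
    (fun o ho => (ha o ho).differentiableWithinAt)
    (fun o ho => (hd o ho).differentiableAt.differentiableWithinAt)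
    (fun o ho => (hd o ho).deriv.symm)
  exact ⟨k, fun o ho => by have := hk (Set.mem_Ioi.2 ho); simp only at this; linarith⟩

theorem exists_mem_domain {x y : ℝ} (hx : x ∈ Set.Ioo (0 : ℝ) 1) (hy : y ∈ Set.Ioo (0 : ℝ) 1) :
    ∃ w, 0 < w ∧ x + y - 1 < w ∧ w < x * y := by
  obtain ⟨w, h1, h2⟩ := exists_between
    (max_lt (mul_pos hx.1 hy.1) (by nlinarith [hx.2, hy.2] : x + y - 1 < x * y))
  exact ⟨w, (le_max_left _ _).trans_lt h1, (le_max_right _ _).trans_lt h1, h2⟩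

/-- Signs on the domain of `AdditiveEquation`, and factorizations of `x + oddsRatio x y w` and
`y + oddsRatio x y w`; the common denominator cancels in their quotient. -/
theorem domain_facts {x y w : ℝ} (hx : x ∈ Set.Ioo (0 : ℝ) 1) (hy : y ∈ Set.Ioo (0 : ℝ) 1)
    (hw1 : x + y - 1 < w) (hw2 : w < x * y) :
    0 < 1 - x - y + w ∧ 0 < x - w ∧ 0 < y - w ∧ 0 < oddsRatio x y w ∧
      x + oddsRatio x y w = (1 - x) * (x - w) / (1 - x - y + w) ∧
      y + oddsRatio x y w = (1 - y) * (y - w) / (1 - x - y + w) := by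
  have hs : 0 < 1 - x - y + w := by linarith
  refine ⟨hs, by nlinarith [hx.1, hx.2, hy.1, hy.2], by nlinarith [hx.1, hx.2, hy.1, hy.2],
    div_pos (by linarith) hs, ?_, ?_⟩ <;>
  · rw [oddsRatio]
    generalize hs' : 1 - x - y + w = s at *
    obtain rfl : w = s - 1 + x + y := by linarith
    field_simp
    ring

/-- All solutions of the additive equation with `a₂`, `a₃`, `b₂`, `b₃` differentiable. -/
theorem AdditiveEquation.exists_eq (h : AdditiveEquation a₁ a₂ a₃ b₁ b₂ b₃)
    (ha₂ : ∀ u ∈ Set.Ioo (0 : ℝ) 1, DifferentiableAt ℝ a₂ u)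
    (hb₂ : ∀ u ∈ Set.Ioo (0 : ℝ) 1, DifferentiableAt ℝ b₂ u)
    (ha₃ : ∀ o, 0 < o → DifferentiableAt ℝ a₃ o) (hb₃ : ∀ o, 0 < o → DifferentiableAt ℝ b₃ o) :
    ∃ c c' e k₁ k₂ k₃ l₁ l₂ l₃ : ℝ,
      (∀ x ∈ Set.Ioo (0 : ℝ) 1, a₁ x = k₁ + (c' + c) * Real.log x - e * Real.log (1 - x)) ∧
      (∀ u ∈ Set.Ioo (0 : ℝ) 1, a₂ u = k₂ + (c' + e) * Real.log u - e * Real.log (1 - u)) ∧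
      (∀ o, 0 < o → a₃ o = k₃ + (c - e) * Real.log o + e * Real.log (1 + o)) ∧
      (∀ x ∈ Set.Ioo (0 : ℝ) 1, b₁ x = l₁ + (c' + c) * Real.log x - e * Real.log (1 - x)) ∧
      (∀ u ∈ Set.Ioo (0 : ℝ) 1, b₂ u = l₂ + (c' + e) * Real.log u - e * Real.log (1 - u)) ∧
      (∀ o, 0 < o → b₃ o = l₃ + (c - e) * Real.log o + e * Real.log (1 + o)) := by
  obtain ⟨c, c', e, h2, h2', h3, h3'⟩ := h.mul_deriv_eq ha₂ hb₂ ha₃ hb₃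
  obtain ⟨k₂, hk₂⟩ := exists_eq_add_log_Ioo ha₂ h2
  obtain ⟨l₂, hl₂⟩ := exists_eq_add_log_Ioo hb₂ h2'
  obtain ⟨k₃, hk₃⟩ := exists_eq_add_log_Ioi ha₃ h3
  obtain ⟨l₃, hl₃⟩ := exists_eq_add_log_Ioi hb₃ h3'
  have h1 : ∀ x ∈ Set.Ioo (0 : ℝ) 1, ∀ y ∈ Set.Ioo (0 : ℝ) 1,
      a₁ x - (c' + c) * Real.log x + e * Real.log (1 - x) + k₂ + k₃ =
        b₁ y - (c' + c) * Real.log y + e * Real.log (1 - y) + l₂ + l₃ := by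
    intro x hx y hy
    obtain ⟨w, hw0, hw1, hw2⟩ := exists_mem_domain hx hy
    obtain ⟨hs, hxw, hyw, ht, hxt, hyt⟩ := domain_facts hx hy hw1 hw2
    have hx0 := hx.1
    have hy0 := hy.1
    have hx1 : 0 < 1 - x := by linarith [hx.2]
    have hy1 : 0 < 1 - y := by linarith [hy.2]
    have q := h x hx y hy w hw0 hw1 hw2
    rw [hk₂ _ ⟨div_pos hw0 hx0, (div_lt_one hx0).2 (by linarith)⟩,
      hl₂ _ ⟨div_pos hw0 hy0, (div_lt_one hy0).2 (by linarith)⟩,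
      hk₃ _ (div_pos ht hx0), hl₃ _ (div_pos ht hy0), one_sub_div hx0.ne', one_sub_div hy0.ne',
      one_add_div hx0.ne', one_add_div hy0.ne', hxt, hyt,
      Real.log_div hw0.ne' hx0.ne', Real.log_div hw0.ne' hy0.ne',
      Real.log_div ht.ne' hx0.ne', Real.log_div ht.ne' hy0.ne',
      Real.log_div hxw.ne' hx0.ne', Real.log_div hyw.ne' hy0.ne',
      Real.log_div (by positivity) hx0.ne', Real.log_div (by positivity) hy0.ne',
      Real.log_div (by positivity) hs.ne', Real.log_div (by positivity) hs.ne',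
      Real.log_mul hx1.ne' hxw.ne', Real.log_mul hy1.ne' hyw.ne'] at q
    linear_combination q
  have m : (1 / 2 : ℝ) ∈ Set.Ioo (0 : ℝ) 1 := by constructor <;> norm_num
  obtain ⟨K, hK⟩ : ∃ K, K = a₁ (1 / 2) - (c' + c) * Real.log (1 / 2) +
      e * Real.log (1 - 1 / 2) + k₂ + k₃ := ⟨_, rfl⟩
  refine ⟨c, c', e, K - k₂ - k₃, k₂, k₃, K - l₂ - l₃, l₂, l₃, fun x hx => ?_, hk₂, hk₃,
    fun y hy => ?_, hl₂, hl₃⟩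
  · have q1 := h1 x hx _ m
    have q2 := h1 _ m _ m
    linarith
  · have q1 := h1 _ m y hy
    linarith

theorem eq_mul_rpow_of_log_eq {F k s t x : ℝ} (hF : 0 < F) (hx : x ∈ Set.Ioo (0 : ℝ) 1)
    (h : Real.log F = k + s * Real.log x + t * Real.log (1 - x)) :
    F = Real.exp k * (x ^ s * (1 - x) ^ t) := by
  rw [← Real.exp_log hF, h, Real.exp_add, Real.exp_add, Real.rpow_def_of_pos hx.1,
    Real.rpow_def_of_pos (by linarith [hx.2] : 0 < 1 - x), mul_comm s, mul_comm t, mul_assoc]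

/-! ### From the additive equation to beta densities -/

/-- One-dimensional positive functions whose products are intertwined by the change of variables
`Ψ` (written in the coordinates `x₁`, `x₂`, `w = x₁ x₂ - x₃` of `H`, with the Jacobian factors of
`ψ₁` and `ψ₂`) are beta densities up to constants. -/
theorem exists_beta_form {f₁ f₂ f₃ g₁ g₂ g₃ : ℝ → ℝ}
    (hf₁ : ∀ u ∈ Set.Ioo (0 : ℝ) 1, 0 < f₁ u) (hf₂ : ∀ u ∈ Set.Ioo (0 : ℝ) 1, 0 < f₂ u)
    (hf₃ : ∀ u ∈ Set.Ioo (0 : ℝ) 1, 0 < f₃ u) (hg₁ : ∀ u ∈ Set.Ioo (0 : ℝ) 1, 0 < g₁ u)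
    (hg₂ : ∀ u ∈ Set.Ioo (0 : ℝ) 1, 0 < g₂ u) (hg₃ : ∀ u ∈ Set.Ioo (0 : ℝ) 1, 0 < g₃ u)
    (df₂ : ∀ u ∈ Set.Ioo (0 : ℝ) 1, DifferentiableAt ℝ f₂ u)
    (df₃ : ∀ u ∈ Set.Ioo (0 : ℝ) 1, DifferentiableAt ℝ f₃ u)
    (dg₂ : ∀ u ∈ Set.Ioo (0 : ℝ) 1, DifferentiableAt ℝ g₂ u)
    (dg₃ : ∀ u ∈ Set.Ioo (0 : ℝ) 1, DifferentiableAt ℝ g₃ u)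
    (h : ∀ x ∈ Set.Ioo (0 : ℝ) 1, ∀ y ∈ Set.Ioo (0 : ℝ) 1, ∀ w,
      0 < w → x + y - 1 < w → w < x * y →
      f₁ x * f₂ (w / x) * f₃ ((x * y - w) / ((1 - x) * (x - w))) * ((1 - y) * (y - w)) =
        g₁ y * g₂ (w / y) * g₃ ((x * y - w) / ((1 - y) * (y - w))) * ((1 - x) * (x - w))) :
    ∃ p q r K L : ℝ, 0 < K ∧ 0 < L ∧
      (∀ x ∈ Set.Ioo (0 : ℝ) 1, ∀ y ∈ Set.Ioo (0 : ℝ) 1, ∀ z ∈ Set.Ioo (0 : ℝ) 1,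
        f₁ x * f₂ y * f₃ z = K * ((x ^ (p + r - 1) * (1 - x) ^ (q + r - 1)) *
          (y ^ (p - 1) * (1 - y) ^ (q + r - 1)) * (z ^ (r - 1) * (1 - z) ^ (q - 1)))) ∧
      (∀ x ∈ Set.Ioo (0 : ℝ) 1, ∀ y ∈ Set.Ioo (0 : ℝ) 1, ∀ z ∈ Set.Ioo (0 : ℝ) 1,
        g₁ x * g₂ y * g₃ z = L * ((x ^ (p + r - 1) * (1 - x) ^ (q + r - 1)) *
          (y ^ (p - 1) * (1 - y) ^ (q + r - 1)) * (z ^ (r - 1) * (1 - z) ^ (q - 1)))) := by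
  have hodds : ∀ o : ℝ, 0 < o → o / (1 + o) ∈ Set.Ioo (0 : ℝ) 1 := fun o ho =>
    ⟨by positivity, (div_lt_one (by positivity)).2 (by linarith)⟩
  have d₂ : ∀ F : ℝ → ℝ, (∀ u ∈ Set.Ioo (0 : ℝ) 1, 0 < F u) →
      (∀ u ∈ Set.Ioo (0 : ℝ) 1, DifferentiableAt ℝ F u) → ∀ u ∈ Set.Ioo (0 : ℝ) 1,
      DifferentiableAt ℝ (fun u => Real.log (F u) - Real.log (1 - u)) u := by
    intro F hF dF u hu
    exact ((dF u hu).log (hF u hu).ne').sub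
      (((differentiableAt_const 1).sub differentiableAt_id).log
        (by simp only [id, Pi.sub_apply]; linarith [hu.2]))
  have d₃ : ∀ F : ℝ → ℝ, (∀ u ∈ Set.Ioo (0 : ℝ) 1, 0 < F u) →
      (∀ u ∈ Set.Ioo (0 : ℝ) 1, DifferentiableAt ℝ F u) → ∀ o : ℝ, 0 < o →
      DifferentiableAt ℝ (fun o => Real.log (F (o / (1 + o)))) o := by
    intro F hF dF o ho
    refine DifferentiableAt.log (DifferentiableAt.comp (g := F) (f := fun o => o / (1 + o)) o
      (dF _ (hodds o ho)) ?_) (hF _ (hodds o ho)).ne'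
    exact differentiableAt_id.div ((differentiableAt_const 1).add differentiableAt_id)
      (by linarith)
  have hadd : AdditiveEquation (fun x => Real.log (f₁ x) - Real.log x - Real.log (1 - x))
      (fun u => Real.log (f₂ u) - Real.log (1 - u)) (fun o => Real.log (f₃ (o / (1 + o))))
      (fun x => Real.log (g₁ x) - Real.log x - Real.log (1 - x))
      (fun u => Real.log (g₂ u) - Real.log (1 - u)) (fun o => Real.log (g₃ (o / (1 + o)))) := by
    intro x hx y hy w hw0 hw1 hw2
    obtain ⟨hs, hxw, hyw, ht, hxt, hyt⟩ := domain_facts hx hy hw1 hw2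
    have hx0 := hx.1
    have hy0 := hy.1
    have hx1 : 0 < 1 - x := by linarith [hx.2]
    have hy1 : 0 < 1 - y := by linarith [hy.2]
    have ex : oddsRatio x y w / x / (1 + oddsRatio x y w / x) =
        (x * y - w) / ((1 - x) * (x - w)) := by
      rw [one_add_div hx0.ne', div_div_div_cancel_right₀ hx0.ne', hxt, oddsRatio,
        div_div_div_cancel_right₀ hs.ne']
    have ey : oddsRatio x y w / y / (1 + oddsRatio x y w / y) =
        (x * y - w) / ((1 - y) * (y - w)) := by
      rw [one_add_div hy0.ne', div_div_div_cancel_right₀ hy0.ne', hyt, oddsRatio,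
        div_div_div_cancel_right₀ hs.ne']
    have px := hf₁ x hx
    have py := hg₁ y hy
    have px2 := hf₂ (w / x) ⟨div_pos hw0 hx0, (div_lt_one hx0).2 (by linarith)⟩
    have py2 := hg₂ (w / y) ⟨div_pos hw0 hy0, (div_lt_one hy0).2 (by linarith)⟩
    have px3 := hf₃ _ (hodds _ (div_pos ht hx0))
    have py3 := hg₃ _ (hodds _ (div_pos ht hy0))
    have q := congrArg Real.log (h x hx y hy w hw0 hw1 hw2)
    rw [ex] at px3
    rw [ey] at py3
    simp only []
    rw [ex, ey, one_sub_div hx0.ne', one_sub_div hy0.ne', Real.log_div hxw.ne' hx0.ne',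
      Real.log_div hyw.ne' hy0.ne']
    rw [Real.log_mul (by positivity) (by positivity), Real.log_mul (by positivity) (by positivity),
      Real.log_mul px.ne' px2.ne', Real.log_mul hy1.ne' hyw.ne',
      Real.log_mul (by positivity) (by positivity), Real.log_mul (by positivity) (by positivity),
      Real.log_mul py.ne' py2.ne', Real.log_mul hx1.ne' hxw.ne'] at q
    linear_combination q
  obtain ⟨c, c', e, k₁, k₂, k₃, l₁, l₂, l₃, h1, h2, h3, h1', h2', h3'⟩ :=
    hadd.exists_eq (d₂ f₂ hf₂ df₂) (d₂ g₂ hg₂ dg₂) (d₃ f₃ hf₃ df₃) (d₃ g₃ hg₃ dg₃)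
  -- passing from the odds `v / (1 - v)` back to `v`
  have back : ∀ (F : ℝ → ℝ) (k v : ℝ), v ∈ Set.Ioo (0 : ℝ) 1 →
      (∀ o, 0 < o → Real.log (F (o / (1 + o))) =
        k + (c - e) * Real.log o + e * Real.log (1 + o)) →
      Real.log (F v) = k + (c - e) * Real.log v + -c * Real.log (1 - v) := by
    intro F k v hv hF
    have hv0 := hv.1
    have hv1 : 0 < 1 - v := by linarith [hv.2]
    have q := hF (v / (1 - v)) (by positivity)
    have e1 : 1 + v / (1 - v) = 1 / (1 - v) := by field_simp; ring
    have e2 : v / (1 - v) / (1 / (1 - v)) = v := by field_simp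
    rw [e1, e2, Real.log_div hv0.ne' hv1.ne', one_div, Real.log_inv] at q
    linear_combination q
  refine ⟨c' + e + 1, 1 - c, c - e + 1, Real.exp k₁ * Real.exp k₂ * Real.exp k₃,
    Real.exp l₁ * Real.exp l₂ * Real.exp l₃, by positivity, by positivity, ?_, ?_⟩
  · intro x hx y hy z hz
    rw [eq_mul_rpow_of_log_eq (hf₁ x hx) hx (k := k₁) (s := c' + e + 1 + (c - e + 1) - 1)
        (t := 1 - c + (c - e + 1) - 1) (by linear_combination h1 x hx),
      eq_mul_rpow_of_log_eq (hf₂ y hy) hy (k := k₂) (s := c' + e + 1 - 1)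
        (t := 1 - c + (c - e + 1) - 1) (by linear_combination h2 y hy),
      eq_mul_rpow_of_log_eq (hf₃ z hz) hz (k := k₃) (s := c - e + 1 - 1)
        (t := 1 - c - 1) (by linear_combination back f₃ k₃ z hz h3)]
    ring
  · intro x hx y hy z hz
    rw [eq_mul_rpow_of_log_eq (hg₁ x hx) hx (k := l₁) (s := c' + e + 1 + (c - e + 1) - 1)
        (t := 1 - c + (c - e + 1) - 1) (by linear_combination h1' x hx),
      eq_mul_rpow_of_log_eq (hg₂ y hy) hy (k := l₂) (s := c' + e + 1 - 1)
        (t := 1 - c + (c - e + 1) - 1) (by linear_combination h2' y hy),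
      eq_mul_rpow_of_log_eq (hg₃ z hz) hz (k := l₃) (s := c - e + 1 - 1)
        (t := 1 - c - 1) (by linear_combination back g₃ l₃ z hz h3')]
    ring

/-! ### Continuous densities of product measures on the cube -/

open Filter Topology Metric

theorem cube_eq_pi : cube = Set.univ.pi fun _ => Set.Ioo (0 : ℝ) 1 := by
  ext y
  simp [cube]

theorem isOpen_cube : IsOpen cube := by
  rw [cube_eq_pi]
  exact isOpen_set_pi Set.finite_univ fun _ _ => isOpen_Ioo

theorem vec_mem_cube {a b c : ℝ} (ha : a ∈ Set.Ioo (0 : ℝ) 1) (hb : b ∈ Set.Ioo (0 : ℝ) 1)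
    (hc : c ∈ Set.Ioo (0 : ℝ) 1) : ![a, b, c] ∈ cube := by
  intro i
  fin_cases i
  exacts [ha, hb, hc]

/-- The value of a density at a point of continuity is the limit of its averages over cubes
(closed balls of the sup norm). -/
theorem tendsto_measure_closedBall_div {F : (Fin 3 → ℝ) → ENNReal} {x : Fin 3 → ℝ}
    (hx : x ∈ cube) (hF : ContinuousAt F x) :
    Tendsto (fun ε => ((volume.restrict cube).withDensity F) (closedBall x ε) /
      ENNReal.ofReal ((2 * ε) ^ 3)) (𝓝[>] 0) (𝓝 (F x)) := by
  have hev : ∀ s ∈ 𝓝 x, ∀ᶠ ε in 𝓝[>] (0 : ℝ), 0 < ε ∧ closedBall x ε ⊆ s := by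
    intro s hs
    obtain ⟨r, hr, hrs⟩ := Metric.nhds_basis_closedBall.mem_iff.1 hs
    filter_upwards [Ioo_mem_nhdsGT hr] with ε hε
    exact ⟨hε.1, (closedBall_subset_closedBall hε.2.le).trans hrs⟩
  have hcube := isOpen_cube.mem_nhds hx
  have hform : ∀ ε : ℝ, closedBall x ε ⊆ cube →
      ((volume.restrict cube).withDensity F) (closedBall x ε) = ∫⁻ z in closedBall x ε, F z := by
    intro ε hε
    rw [withDensity_apply _ measurableSet_closedBall,
      Measure.restrict_restrict measurableSet_closedBall, Set.inter_eq_left.2 hε]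
  have hvol : ∀ ε : ℝ, 0 < ε → volume (closedBall x ε) = ENNReal.ofReal ((2 * ε) ^ 3) := by
    intro ε hε
    rw [Real.volume_pi_closedBall x hε.le, Fintype.card_fin]
  refine tendsto_order.2 ⟨fun a ha => ?_, fun a ha => ?_⟩
  · obtain ⟨a', h1, h2⟩ := exists_between ha
    filter_upwards [hev _ (inter_mem hcube (hF.eventually (lt_mem_nhds h2)))] with ε ⟨hε, hs⟩
    have hv : 0 < ENNReal.ofReal ((2 * ε) ^ 3) := ENNReal.ofReal_pos.2 (by positivity)
    refine h1.trans_le ((ENNReal.le_div_iff_mul_le (Or.inl hv.ne')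
      (Or.inl ENNReal.ofReal_ne_top)).2 ?_)
    rw [hform ε (hs.trans Set.inter_subset_left), ← hvol ε hε, ← setLIntegral_const]
    exact setLIntegral_mono' measurableSet_closedBall fun z hz => (hs hz).2.le
  · obtain ⟨a', h1, h2⟩ := exists_between ha
    filter_upwards [hev _ (inter_mem hcube (hF.eventually (gt_mem_nhds h1)))] with ε ⟨hε, hs⟩
    refine lt_of_le_of_lt (ENNReal.div_le_of_le_mul ?_) h2
    rw [hform ε (hs.trans Set.inter_subset_left), ← hvol ε hε, ← setLIntegral_const]
    exact setLIntegral_mono' measurableSet_closedBall fun z hz => (hs hz).2.le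

/-- A continuous density of a product measure factors through its one-dimensional slices, at every
point and not only almost everywhere. -/
theorem density_mul_sq_eq {ν : Fin 3 → Measure ℝ} [∀ i, IsProbabilityMeasure (ν i)]
    {f : (Fin 3 → ℝ) → ℝ} (hf : ContinuousOn f cube) (hpos : ∀ y ∈ cube, 0 < f y)
    (h : Measure.pi ν = (volume.restrict cube).withDensity (fun y => ENNReal.ofReal (f y)))
    {y c : Fin 3 → ℝ} (hy : y ∈ cube) (hc : c ∈ cube) :
    f y * f c ^ 2 = f ![y 0, c 1, c 2] * f ![c 0, y 1, c 2] * f ![c 0, c 1, y 2] := by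
  have m1 : ![y 0, c 1, c 2] ∈ cube := vec_mem_cube (hy 0) (hc 1) (hc 2)
  have m2 : ![c 0, y 1, c 2] ∈ cube := vec_mem_cube (hc 0) (hy 1) (hc 2)
  have m3 : ![c 0, c 1, y 2] ∈ cube := vec_mem_cube (hc 0) (hc 1) (hy 2)
  have T : ∀ x ∈ cube, Tendsto (fun ε => Measure.pi ν (closedBall x ε) /
      ENNReal.ofReal ((2 * ε) ^ 3)) (𝓝[>] 0) (𝓝 (ENNReal.ofReal (f x))) := by
    intro x hx
    rw [h]
    exact tendsto_measure_closedBall_div hx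
      (ENNReal.continuous_ofReal.continuousAt.comp (hf.continuousAt (isOpen_cube.mem_nhds hx)))
  have T3 : ∀ a ∈ cube, ∀ b ∈ cube, ∀ d ∈ cube, Tendsto (fun ε =>
      Measure.pi ν (closedBall a ε) / ENNReal.ofReal ((2 * ε) ^ 3) *
      (Measure.pi ν (closedBall b ε) / ENNReal.ofReal ((2 * ε) ^ 3)) *
      (Measure.pi ν (closedBall d ε) / ENNReal.ofReal ((2 * ε) ^ 3))) (𝓝[>] 0)
      (𝓝 (ENNReal.ofReal (f a * f b * f d))) := by
    intro a ha b hb d hd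
    rw [ENNReal.ofReal_mul (mul_pos (hpos a ha) (hpos b hb)).le, ENNReal.ofReal_mul (hpos a ha).le]
    exact ENNReal.Tendsto.mul (ENNReal.Tendsto.mul (T a ha) (Or.inr ENNReal.ofReal_ne_top) (T b hb)
      (Or.inr ENNReal.ofReal_ne_top)) (Or.inr ENNReal.ofReal_ne_top) (T d hd)
      (Or.inr (ENNReal.mul_ne_top ENNReal.ofReal_ne_top ENNReal.ofReal_ne_top))
  have hball : ∀ (x : Fin 3 → ℝ) (ε : ℝ), Measure.pi ν (closedBall x ε) =
      ν 0 (closedBall (x 0) ε) * ν 1 (closedBall (x 1) ε) * ν 2 (closedBall (x 2) ε) := by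
    intro x ε
    rw [closedBall_pi', Measure.pi_pi, Fin.prod_univ_three]
  have e := tendsto_nhds_unique_of_eventuallyEq (T3 y hy c hc c hc) (T3 _ m1 _ m2 _ m3)
    (Eventually.of_forall fun ε => by
      simp only [hball, Matrix.cons_val_zero, Matrix.cons_val_one, Matrix.cons_val,
        div_eq_mul_inv]
      ring)
  have p1 := mul_pos (mul_pos (hpos _ hy) (hpos _ hc)) (hpos _ hc)
  have p2 := mul_pos (mul_pos (hpos _ m1) (hpos _ m2)) (hpos _ m3)
  rw [ENNReal.ofReal_eq_ofReal_iff p1.le p2.le] at e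
  rw [← e]
  ring

/-! ### The change of variables -/

/-- `Ψ` given by its explicit formula. -/
noncomputable def psiFormula (y : Fin 3 → ℝ) : Fin 3 → ℝ :=
  ![y 1 + (1 - y 0) * (1 - y 1) * y 2,
    y 0 * y 1 / (y 1 + (1 - y 0) * (1 - y 1) * y 2),
    y 0 * y 2 / ((1 - (1 - y 0) * y 2) * (y 1 + y 2 * (1 - y 1)))]

theorem psiFormula_psi1 {x : Fin 3 → ℝ} (hx : x ∈ H) : psiFormula (psi1 x) = psi2 x := by
  rw [psiFormula, ← Psi_apply (psi1_bijOn.mapsTo hx), Psi, Function.comp_apply,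
    psi1_bijOn.injOn.leftInvOn_invFunOn hx]

/-- Exchanging the first two coordinates of `H` exchanges `ψ₁` and `ψ₂`, so `Ψ` is an involution. -/
theorem psiFormula_mem_and_involutive {y : Fin 3 → ℝ} (hy : y ∈ cube) :
    psiFormula y ∈ cube ∧ psiFormula (psiFormula y) = y := by
  obtain ⟨x, hx, rfl⟩ := psi1_bijOn.surjOn hy
  obtain ⟨h0, h1, h2, h3⟩ := hx
  have hs : ![x 1, x 0, x 2] ∈ H := by
    refine ⟨h1, h0, h2, ?_⟩
    change x 2 < min (x 1 * x 0) ((1 - x 1) * (1 - x 0))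
    rwa [mul_comm (x 1), mul_comm (1 - x 1)]
  have e1 : psi2 x = psi1 ![x 1, x 0, x 2] := by
    simp [psi1, psi2, mul_comm (x 0)]
  have e2 : psi1 x = psi2 ![x 1, x 0, x 2] := by
    simp [psi1, psi2, mul_comm (x 0)]
  rw [psiFormula_psi1 ⟨h0, h1, h2, h3⟩, e1]
  refine ⟨psi1_bijOn.mapsTo hs, ?_⟩
  rw [psiFormula_psi1 hs, e2]

theorem psiFormula_image_cube : psiFormula '' cube = cube := by
  apply Set.Subset.antisymm
  · rintro _ ⟨y, hy, rfl⟩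
    exact (psiFormula_mem_and_involutive hy).1
  · intro y hy
    exact ⟨_, (psiFormula_mem_and_involutive hy).1, (psiFormula_mem_and_involutive hy).2⟩

theorem injOn_psiFormula : Set.InjOn psiFormula cube :=
  Set.LeftInvOn.injOn (f₁' := psiFormula) fun _ hy => (psiFormula_mem_and_involutive hy).2

/-- The absolute value of the Jacobian determinant of `Ψ`. -/
noncomputable def psiJacobian (y : Fin 3 → ℝ) : ℝ :=
  y 0 / ((1 - (1 - y 0) * y 2) * (y 1 + y 2 * (1 - y 1)))

theorem denominators_pos {y : Fin 3 → ℝ} (hy : y ∈ cube) :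
    0 < y 1 + (1 - y 0) * (1 - y 1) * y 2 ∧ 0 < 1 - (1 - y 0) * y 2 ∧
      0 < y 1 + y 2 * (1 - y 1) := by
  obtain ⟨h0, h0'⟩ := hy 0
  obtain ⟨h1, h1'⟩ := hy 1
  obtain ⟨h2, h2'⟩ := hy 2
  have a0 : 0 < 1 - y 0 := by linarith
  have a1 : 0 < 1 - y 1 := by linarith
  exact ⟨by positivity, by nlinarith, by positivity⟩

theorem psiJacobian_pos {y : Fin 3 → ℝ} (hy : y ∈ cube) : 0 < psiJacobian y := by
  obtain ⟨h1, h2, h3⟩ := denominators_pos hy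
  exact div_pos (hy 0).1 (mul_pos h2 h3)

/-- The linear form on `ℝ³` with coefficients `a`, `b`, `c`. -/
noncomputable def linForm (a b c : ℝ) : (Fin 3 → ℝ) →L[ℝ] ℝ :=
  a • ContinuousLinearMap.proj (R := ℝ) (φ := fun _ : Fin 3 => ℝ) 0 +
    b • ContinuousLinearMap.proj (R := ℝ) (φ := fun _ : Fin 3 => ℝ) 1 +
    c • ContinuousLinearMap.proj (R := ℝ) (φ := fun _ : Fin 3 => ℝ) 2

theorem linForm_apply (a b c : ℝ) (v : Fin 3 → ℝ) :
    linForm a b c v = a * v 0 + b * v 1 + c * v 2 := by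
  simp [linForm]

theorem det_pi_linForm (a b c d e f g h i : ℝ) :
    (ContinuousLinearMap.pi ![linForm a b c, linForm d e f, linForm g h i]).det =
      a * e * i - a * f * h - b * d * i + b * f * g + c * d * h - c * e * g := by
  rw [ContinuousLinearMap.det, ← LinearMap.det_toMatrix', Matrix.det_fin_three]
  simp [LinearMap.toMatrix'_apply, linForm_apply]

theorem hasFDerivAt_vec {f g h : (Fin 3 → ℝ) → ℝ} {f' g' h' : (Fin 3 → ℝ) →L[ℝ] ℝ}
    {y : Fin 3 → ℝ} (hf : HasFDerivAt f f' y) (hg : HasFDerivAt g g' y)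
    (hh : HasFDerivAt h h' y) :
    HasFDerivAt (fun y => ![f y, g y, h y]) (ContinuousLinearMap.pi ![f', g', h']) y := by
  refine hasFDerivAt_pi.2 fun i => ?_
  fin_cases i
  exacts [hf, hg, hh]

/-- `Ψ` is differentiable on the cube; it reverses orientation there, so the determinant itself is
`-psiJacobian y`. -/
theorem exists_hasFDerivAt_psiFormula {y : Fin 3 → ℝ} (hy : y ∈ cube) :
    ∃ A : (Fin 3 → ℝ) →L[ℝ] (Fin 3 → ℝ), HasFDerivAt psiFormula A y ∧
      |A.det| = psiJacobian y := by
  obtain ⟨hD, hE, hF⟩ := denominators_pos hy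
  have hp : ∀ i : Fin 3, HasFDerivAt (fun y : Fin 3 → ℝ => y i)
    (ContinuousLinearMap.proj (R := ℝ) (φ := fun _ : Fin 3 => ℝ) i) y := fun i =>
      hasFDerivAt_apply i y
  have dD : HasFDerivAt (fun y : Fin 3 → ℝ => y 1 + (1 - y 0) * (1 - y 1) * y 2)
      (linForm (-((1 - y 1) * y 2)) (1 - (1 - y 0) * y 2) ((1 - y 0) * (1 - y 1))) y := by
    refine HasFDerivAt.congr_fderiv
      ((hp 1).add ((((hp 0).const_sub 1).mul ((hp 1).const_sub 1)).mul (hp 2))) ?_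
    ext1 v
    simp [linForm_apply]
    ring
  have dG : HasFDerivAt
      (fun y : Fin 3 → ℝ => (1 - (1 - y 0) * y 2) * (y 1 + y 2 * (1 - y 1)))
      (linForm (y 2 * (y 1 + y 2 * (1 - y 1))) ((1 - (1 - y 0) * y 2) * (1 - y 2))
        ((1 - (1 - y 0) * y 2) * (1 - y 1) - (1 - y 0) * (y 1 + y 2 * (1 - y 1)))) y := by
    refine HasFDerivAt.congr_fderiv (((((hp 0).const_sub 1).mul (hp 2)).const_sub 1).mul
      ((hp 1).add ((hp 2).mul ((hp 1).const_sub 1)))) ?_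
    ext1 v
    simp [linForm_apply]
    ring
  generalize hDd : y 1 + (1 - y 0) * (1 - y 1) * y 2 = D at hD dD
  generalize hEd : 1 - (1 - y 0) * y 2 = E at hE dD dG
  generalize hFd : y 1 + y 2 * (1 - y 1) = F at hF dG
  have hG : 0 < E * F := mul_pos hE hF
  have d2 : HasFDerivAt
      (fun y : Fin 3 → ℝ => y 0 * y 1 / (y 1 + (1 - y 0) * (1 - y 1) * y 2))
      (linForm ((y 1 * D + y 0 * y 1 * ((1 - y 1) * y 2)) / D ^ 2)
        ((y 0 * D - y 0 * y 1 * E) / D ^ 2)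
        (-(y 0 * y 1 * ((1 - y 0) * (1 - y 1))) / D ^ 2)) y := by
    refine HasFDerivAt.congr_fderiv (((hp 0).mul (hp 1)).mul
      ((hasDerivAt_inv (by rw [hDd]; exact hD.ne')).comp_hasFDerivAt y dD)) ?_
    ext1 v
    simp [linForm_apply, hDd]
    field_simp
    ring
  have d3 : HasFDerivAt
      (fun y : Fin 3 → ℝ => y 0 * y 2 / ((1 - (1 - y 0) * y 2) * (y 1 + y 2 * (1 - y 1))))
      (linForm ((y 2 * (E * F) - y 0 * y 2 * (y 2 * F)) / (E * F) ^ 2)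
        (-(y 0 * y 2 * (E * (1 - y 2))) / (E * F) ^ 2)
        ((y 0 * (E * F) - y 0 * y 2 * (E * (1 - y 1) - (1 - y 0) * F)) / (E * F) ^ 2)) y := by
    refine HasFDerivAt.congr_fderiv (((hp 0).mul (hp 2)).mul
      ((hasDerivAt_inv (by rw [hEd, hFd]; exact hG.ne')).comp_hasFDerivAt y dG)) ?_
    ext1 v
    simp [linForm_apply, hEd, hFd]
    field_simp
    ring
  refine ⟨_, hasFDerivAt_vec dD d2 d3, ?_⟩
  rw [det_pi_linForm, psiJacobian, hEd, hFd, ← abs_neg, ← abs_of_pos (div_pos (hy 0).1 hG)]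
  congr 1
  field_simp
  subst hDd hEd hFd
  ring

theorem measurable_psiFormula : Measurable psiFormula := by
  refine measurable_pi_iff.2 fun i => ?_
  fin_cases i
  · change Measurable fun y : Fin 3 → ℝ => y 1 + (1 - y 0) * (1 - y 1) * y 2
    fun_prop
  · change Measurable fun y : Fin 3 → ℝ => y 0 * y 1 / (y 1 + (1 - y 0) * (1 - y 1) * y 2)
    fun_prop
  · change Measurable fun y : Fin 3 → ℝ =>
      y 0 * y 2 / ((1 - (1 - y 0) * y 2) * (y 1 + y 2 * (1 - y 1)))
    fun_prop

/-- The image under the involution `Ψ` of the law with density `f`. -/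
theorem map_psiFormula_withDensity {f : (Fin 3 → ℝ) → ℝ} (hpos : ∀ y ∈ cube, 0 < f y) :
    ((volume.restrict cube).withDensity fun y => ENNReal.ofReal (f y)).map psiFormula =
      (volume.restrict cube).withDensity
        fun z => ENNReal.ofReal (f (psiFormula z) * psiJacobian z) := by
  choose! A hA hdet using fun y (hy : y ∈ cube) => exists_hasFDerivAt_psiFormula hy
  have hmc : MeasurableSet cube := isOpen_cube.measurableSet
  refine Measure.ext fun S hS => ?_
  have hpre := measurable_psiFormula hS
  rw [Measure.map_apply measurable_psiFormula hS, withDensity_apply _ hpre,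
    withDensity_apply _ hS, ← lintegral_indicator hpre, ← lintegral_indicator hS]
  nth_rewrite 1 [← psiFormula_image_cube]
  rw [lintegral_image_eq_lintegral_abs_det_fderiv_mul volume hmc
    (fun y hy => (hA y hy).hasFDerivWithinAt) injOn_psiFormula]
  refine setLIntegral_congr_fun hmc fun z hz => ?_
  obtain ⟨hm, hinv⟩ := psiFormula_mem_and_involutive hz
  by_cases hzS : z ∈ S
  · have : psiFormula z ∈ psiFormula ⁻¹' S := by rwa [Set.mem_preimage, hinv]
    simp only [Set.indicator_of_mem hzS, Set.indicator_of_mem this]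
    rw [hdet z hz, mul_comm, ENNReal.ofReal_mul (hpos _ hm).le]
  · have : psiFormula z ∉ psiFormula ⁻¹' S := by rwa [Set.mem_preimage, hinv]
    simp only [Set.indicator_of_notMem hzS, Set.indicator_of_notMem this, mul_zero]

/-! ### Beta weights -/

/-- The unnormalized density `x ^ (a - 1) (1 - x) ^ (b - 1)` of a beta law. -/
noncomputable def betaWeight (a b x : ℝ) : ENNReal :=
  ENNReal.ofReal (x ^ (a - 1) * (1 - x) ^ (b - 1))

@[fun_prop]
theorem measurable_betaWeight (a b : ℝ) : Measurable (betaWeight a b) := by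
  unfold betaWeight
  fun_prop

theorem setLIntegral_betaWeight_comm (a b : ℝ) :
    ∫⁻ x in Set.Ioo (0 : ℝ) 1, betaWeight a b x = ∫⁻ x in Set.Ioo (0 : ℝ) 1, betaWeight b a x := by
  rw [← lintegral_indicator measurableSet_Ioo, ← lintegral_indicator measurableSet_Ioo,
    ← lintegral_sub_left_eq_self _ 1]
  refine lintegral_congr fun x => ?_
  by_cases hx : x ∈ Set.Ioo (0 : ℝ) 1
  · have hx' : 1 - x ∈ Set.Ioo (0 : ℝ) 1 := ⟨by linarith [hx.2], by linarith [hx.1]⟩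
    rw [Set.indicator_of_mem hx, Set.indicator_of_mem hx', betaWeight, betaWeight,
      sub_sub_cancel, mul_comm]
  · have hx' : 1 - x ∉ Set.Ioo (0 : ℝ) 1 := fun h => hx ⟨by linarith [h.2], by linarith [h.1]⟩
    rw [Set.indicator_of_notMem hx, Set.indicator_of_notMem hx']

theorem pos_of_setLIntegral_betaWeight_ne_top {a b : ℝ}
    (h : ∫⁻ x in Set.Ioo (0 : ℝ) 1, betaWeight a b x ≠ ⊤) : 0 < a := by
  have hk : (0 : ℝ) < (1 / 2) ^ |b - 1| := by positivity
  -- near `0` the second factor is bounded below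
  have hle : ∀ x ∈ Set.Ioo (0 : ℝ) (1 / 2),
      ENNReal.ofReal ((1 / 2) ^ |b - 1|) * ENNReal.ofReal (x ^ (a - 1)) ≤ betaWeight a b x := by
    rintro x ⟨hx, hx2⟩
    rw [← ENNReal.ofReal_mul hk.le, betaWeight, mul_comm]
    refine ENNReal.ofReal_le_ofReal (mul_le_mul_of_nonneg_left ?_ (by positivity))
    calc (1 / 2 : ℝ) ^ |b - 1| ≤ (1 - x) ^ |b - 1| :=
          Real.rpow_le_rpow (by norm_num) (by linarith) (abs_nonneg _)
      _ ≤ (1 - x) ^ (b - 1) :=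
          Real.rpow_le_rpow_of_exponent_ge (by linarith) (by linarith) (le_abs_self _)
  have h1 : ENNReal.ofReal ((1 / 2) ^ |b - 1|) *
      ∫⁻ x in Set.Ioo (0 : ℝ) (1 / 2), ENNReal.ofReal (x ^ (a - 1)) ≠ ⊤ := by
    rw [← lintegral_const_mul _ (by fun_prop)]
    refine ne_top_of_le_ne_top h ((setLIntegral_mono' measurableSet_Ioo hle).trans ?_)
    exact lintegral_mono_set (Set.Ioo_subset_Ioo_right (by norm_num))
  have h2 : ∫⁻ x in Set.Ioo (0 : ℝ) (1 / 2), ENNReal.ofReal (x ^ (a - 1)) ≠ ⊤ := fun h =>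
    h1 (by rw [h, ENNReal.mul_top (ENNReal.ofReal_pos.2 hk).ne'])
  have h3 : IntegrableOn (fun x : ℝ => x ^ (a - 1)) (Set.Ioo 0 (1 / 2)) := by
    refine (lintegral_ofReal_ne_top_iff_integrable (by fun_prop) ?_).1 h2
    filter_upwards [ae_restrict_mem measurableSet_Ioo] with x hx
    have := hx.1
    exact Real.rpow_nonneg this.le _
  have := (intervalIntegral.integrableOn_Ioo_rpow_iff (by norm_num)).1 h3
  linarith

theorem betaMeasure_apply_eq {a b : ℝ} (ha : 0 < a) (hb : 0 < b) {S : Set ℝ}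
    (hS : MeasurableSet S) : betaMeasure a b S =
      ENNReal.ofReal (1 / beta a b) *
        ∫⁻ x in Set.Ioo (0 : ℝ) 1, S.indicator (betaWeight a b) x := by
  rw [betaMeasure, withDensity_apply _ hS, ← lintegral_indicator hS,
    ← lintegral_const_mul _ ((measurable_betaWeight a b).indicator hS),
    ← lintegral_indicator measurableSet_Ioo]
  refine lintegral_congr fun x => ?_
  have hp : 0 ≤ 1 / beta a b := (one_div_pos.2 (beta_pos ha hb)).le
  by_cases hx : x ∈ Set.Ioo (0 : ℝ) 1 <;> by_cases hxS : x ∈ S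
  · rw [Set.indicator_of_mem hxS, Set.indicator_of_mem hx, Set.indicator_of_mem hxS,
      betaPDF_of_pos_lt_one hx.1 hx.2, betaWeight, ← ENNReal.ofReal_mul hp, mul_assoc]
  · simp [hxS, Set.indicator_apply]
  · rw [Set.indicator_of_mem hxS, Set.indicator_of_notMem hx, betaPDF_eq,
      if_neg (by simpa using hx), ENNReal.ofReal_zero]
  · simp [hxS, Set.indicator_apply]

theorem lintegral_pi_prod_eq {h : Fin 3 → ℝ → ENNReal} (hh : ∀ i, Measurable (h i)) :
    ∫⁻ y in cube, ∏ i, h i (y i) = ∏ i, ∫⁻ x in Set.Ioo (0 : ℝ) 1, h i x := by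
  have : IsProbabilityMeasure ((volume : Measure ℝ).restrict (Set.Ioo 0 1)) :=
    ⟨by simp [Real.volume_Ioo]⟩
  rw [cube_eq_pi, volume_pi, Measure.restrict_pi_pi]
  refine (lintegral_prod_eq_prod_lintegral_of_indepFun Finset.univ (fun i (y : Fin 3 → ℝ) => h i (y i))
    (iIndepFun_pi fun i => (hh i).aemeasurable)
    (fun i => (hh i).comp (measurable_pi_apply i))).trans ?_
  refine Finset.prod_congr rfl fun i _ => ?_
  exact (measurePreserving_eval _ i).lintegral_comp (hh i)

/-- A probability measure on the cube whose density is a constant times a product of beta weights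
is a product of beta laws; integrability of the density forces the parameters to be positive. -/
theorem eq_pi_betaMeasure {μ : Measure (Fin 3 → ℝ)} [IsProbabilityMeasure μ]
    {f : (Fin 3 → ℝ) → ℝ} {a b : Fin 3 → ℝ} {K : ℝ} (hK : 0 < K)
    (hf : ∀ y ∈ cube, f y = K * ∏ i, (y i ^ (a i - 1) * (1 - y i) ^ (b i - 1)))
    (hμ : μ = (volume.restrict cube).withDensity fun y => ENNReal.ofReal (f y)) :
    (∀ i, 0 < a i ∧ 0 < b i) ∧ μ = Measure.pi fun i => betaMeasure (a i) (b i) := by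
  have hbox : ∀ s : Fin 3 → Set ℝ, (∀ i, MeasurableSet (s i)) → μ (Set.univ.pi s) =
      ENNReal.ofReal K *
        ∏ i, ∫⁻ x in Set.Ioo (0 : ℝ) 1, (s i).indicator (betaWeight (a i) (b i)) x := by
    intro s hs
    have hsm := MeasurableSet.univ_pi hs
    have hm : ∀ i, Measurable ((s i).indicator (betaWeight (a i) (b i))) := fun i =>
      (measurable_betaWeight _ _).indicator (hs i)
    rw [hμ, withDensity_apply _ hsm, ← lintegral_indicator hsm, ← lintegral_pi_prod_eq hm,
      ← lintegral_const_mul _ (by fun_prop)]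
    refine setLIntegral_congr_fun isOpen_cube.measurableSet fun y hy => ?_
    by_cases hys : y ∈ Set.univ.pi s
    · simp only [Set.indicator_of_mem hys, hf y hy]
      rw [ENNReal.ofReal_mul hK.le, ENNReal.ofReal_prod_of_nonneg]
      · congr 1
        refine Finset.prod_congr rfl fun i _ => ?_
        rw [Set.indicator_of_mem (hys i (Set.mem_univ i)), betaWeight]
      · intro i _
        have h1 := (hy i).1
        have h2 : 0 < 1 - y i := by linarith [(hy i).2]
        positivity
    · simp only [Set.indicator_of_notMem hys]
      obtain ⟨i, hi⟩ : ∃ i, y i ∉ s i := by simpa using hys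
      rw [Finset.prod_eq_zero (Finset.mem_univ i) (Set.indicator_of_notMem hi _), mul_zero]
  have htot := hbox (fun _ => Set.univ) fun _ => MeasurableSet.univ
  simp only [Set.pi_univ, measure_univ, Set.indicator_univ] at htot
  have hprod : ∏ i, ∫⁻ x in Set.Ioo (0 : ℝ) 1, betaWeight (a i) (b i) x ≠ ⊤ := fun h => by
    rw [h, ENNReal.mul_top (ENNReal.ofReal_pos.2 hK).ne'] at htot
    exact ENNReal.one_ne_top htot
  have hprod0 : ∏ i, ∫⁻ x in Set.Ioo (0 : ℝ) 1, betaWeight (a i) (b i) x ≠ 0 := fun h => by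
    rw [h, mul_zero] at htot
    exact one_ne_zero htot
  have hfin : ∀ i, ∫⁻ x in Set.Ioo (0 : ℝ) 1, betaWeight (a i) (b i) x ≠ ⊤ := by
    intro i hi
    rw [← Finset.mul_prod_erase _ _ (Finset.mem_univ i), hi] at hprod hprod0
    exact hprod (ENNReal.top_mul (right_ne_zero_of_mul hprod0))
  have hab : ∀ i, 0 < a i ∧ 0 < b i := fun i =>
    ⟨pos_of_setLIntegral_betaWeight_ne_top (hfin i), pos_of_setLIntegral_betaWeight_ne_top
      (by rw [setLIntegral_betaWeight_comm]; exact hfin i)⟩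
  have : ∀ i, IsProbabilityMeasure (betaMeasure (a i) (b i)) := fun i =>
    isProbabilityMeasureBeta (hab i).1 (hab i).2
  refine ⟨hab, (Measure.pi_eq fun s hs => ?_).symm⟩
  -- both total masses are `1`, so the normalizing constants agree
  have hC : ENNReal.ofReal K = ∏ i, ENNReal.ofReal (1 / beta (a i) (b i)) := by
    have h1 : ∏ i, betaMeasure (a i) (b i) Set.univ = 1 := by simp
    simp only [betaMeasure_apply_eq (hab _).1 (hab _).2 MeasurableSet.univ, Set.indicator_univ,
      Finset.prod_mul_distrib] at h1
    exact (ENNReal.mul_left_inj hprod0 hprod).1 (htot.symm.trans h1.symm)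
  rw [hbox s hs, hC, ← Finset.prod_mul_distrib]
  exact Finset.prod_congr rfl fun i _ => (betaMeasure_apply_eq (hab i).1 (hab i).2 (hs i)).symm

/-! ### Identification of the laws -/

/-- A positive differentiable density of a product law on the cube is a product of positive
differentiable functions of one variable. -/
theorem exists_slices {ν : Fin 3 → Measure ℝ} [∀ i, IsProbabilityMeasure (ν i)]
    {f : (Fin 3 → ℝ) → ℝ} (hf : ∀ y ∈ cube, DifferentiableAt ℝ f y)
    (hpos : ∀ y ∈ cube, 0 < f y)
    (h : Measure.pi ν = (volume.restrict cube).withDensity (fun y => ENNReal.ofReal (f y))) :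
    ∃ F : Fin 3 → ℝ → ℝ, (∀ i, ∀ u ∈ Set.Ioo (0 : ℝ) 1, 0 < F i u) ∧
      (∀ i, ∀ u ∈ Set.Ioo (0 : ℝ) 1, DifferentiableAt ℝ (F i) u) ∧
      ∀ y ∈ cube, f y = F 0 (y 0) * F 1 (y 1) * F 2 (y 2) := by
  have hm : (1 / 2 : ℝ) ∈ Set.Ioo (0 : ℝ) 1 := by constructor <;> norm_num
  obtain ⟨c, hc⟩ : ∃ c : Fin 3 → ℝ, c ∈ cube := ⟨fun _ => 1 / 2, fun _ => hm⟩
  have hcpos := hpos c hc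
  have hmem : ∀ i, ∀ u ∈ Set.Ioo (0 : ℝ) 1, Function.update c i u ∈ cube := by
    intro i u hu j
    rcases eq_or_ne j i with rfl | hj
    · rwa [Function.update_self]
    · rw [Function.update_of_ne hj]
      exact hc j
  have hd : ∀ i, ∀ u ∈ Set.Ioo (0 : ℝ) 1,
      DifferentiableAt ℝ (fun u => f (Function.update c i u)) u := fun i u hu =>
    DifferentiableAt.comp (g := f) u (hf _ (hmem i u hu))
      (hasDerivAt_update c i u).differentiableAt
  -- the slices through `c`, with the factor `f c ^ 2` of `density_mul_sq_eq` put into the first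
  refine ⟨fun i u => f (Function.update c i u) / if i = 0 then f c ^ 2 else 1,
    fun i u hu => div_pos (hpos _ (hmem i u hu)) (by split_ifs <;> positivity),
    fun i u hu => (hd i u hu).div_const _, fun y hy => ?_⟩
  have e := density_mul_sq_eq (fun y hy => (hf y hy).continuousAt.continuousWithinAt) hpos h hy hc
  have e0 : Function.update c 0 (y 0) = ![y 0, c 1, c 2] := by
    funext i; fin_cases i <;> rfl
  have e1 : Function.update c 1 (y 1) = ![c 0, y 1, c 2] := by
    funext i; fin_cases i <;> rfl
  have e2 : Function.update c 2 (y 2) = ![c 0, c 1, y 2] := by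
    funext i; fin_cases i <;> rfl
  simp only [e0, e1, e2, if_true, one_ne_zero, if_false, div_one,
    show (2 : Fin 3) ≠ 0 by decide]
  field_simp
  linear_combination e

/-- The relation between corresponding points of the two cubes, in the coordinates
`x = x₁`, `y = x₂`, `w = x₁ x₂ - x₃` of `H`. -/
theorem psiFormula_coordinates {x y w : ℝ} (hx : x ∈ Set.Ioo (0 : ℝ) 1)
    (hy : y ∈ Set.Ioo (0 : ℝ) 1) (hw0 : 0 < w) (hw1 : x + y - 1 < w) (hw2 : w < x * y) :
    ![x, w / x, (x * y - w) / ((1 - x) * (x - w))] ∈ cube ∧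
    ![y, w / y, (x * y - w) / ((1 - y) * (y - w))] ∈ cube ∧
    psiFormula ![y, w / y, (x * y - w) / ((1 - y) * (y - w))] =
      ![x, w / x, (x * y - w) / ((1 - x) * (x - w))] ∧
    psiJacobian ![y, w / y, (x * y - w) / ((1 - y) * (y - w))] =
      (1 - y) * (y - w) / ((1 - x) * (x - w)) := by
  obtain ⟨hs, hxw, hyw, -, -, -⟩ := domain_facts hx hy hw1 hw2
  have hH : ![x, y, x * y - w] ∈ H := by
    refine ⟨hx, hy, ?_, ?_⟩
    · change 0 < x * y - w
      linarith
    · change x * y - w < min (x * y) ((1 - x) * (1 - y))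
      exact lt_min (by linarith) (by linarith)
  have e1 : psi1 ![x, y, x * y - w] = ![x, w / x, (x * y - w) / ((1 - x) * (x - w))] := by
    simp [psi1]
  have e2 : psi2 ![x, y, x * y - w] = ![y, w / y, (x * y - w) / ((1 - y) * (y - w))] := by
    simp [psi2]
  have m1 := psi1_bijOn.mapsTo hH
  have e := psiFormula_psi1 hH
  rw [e1] at m1 e
  rw [e2] at e
  obtain ⟨m2, hinv⟩ := psiFormula_mem_and_involutive m1
  rw [e] at m2 hinv
  refine ⟨m1, m2, hinv, ?_⟩
  have hx0 := hx.1
  have hy0 := hy.1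
  have hx1 : 0 < 1 - x := by linarith [hx.2]
  have hy1 : 0 < 1 - y := by linarith [hy.2]
  have k1 : 1 - (1 - y) * ((x * y - w) / ((1 - y) * (y - w))) = y * (1 - x) / (y - w) := by
    field_simp
    ring
  have k2 : w / y + (x * y - w) / ((1 - y) * (y - w)) * (1 - w / y) = (x - w) / (1 - y) := by
    field_simp
    ring
  change y / ((1 - (1 - y) * ((x * y - w) / ((1 - y) * (y - w)))) *
    (w / y + (x * y - w) / ((1 - y) * (y - w)) * (1 - w / y))) = _
  rw [k1, k2]
  field_simp

theorem differentiableAt_psiJacobian {y : Fin 3 → ℝ} (hy : y ∈ cube) :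
    DifferentiableAt ℝ psiJacobian y := by
  obtain ⟨-, hE, hF⟩ := denominators_pos hy
  unfold psiJacobian
  have := (mul_pos hE hF).ne'
  fun_prop (disch := assumption)

theorem law_eq_betaProduct {μ : Measure (Fin 3 → ℝ)} [IsProbabilityMeasure μ]
    {f : (Fin 3 → ℝ) → ℝ} {p q r K : ℝ} {F : Fin 3 → ℝ → ℝ} (hK : 0 < K)
    (hF : ∀ y ∈ cube, f y = F 0 (y 0) * F 1 (y 1) * F 2 (y 2))
    (hform : ∀ x ∈ Set.Ioo (0 : ℝ) 1, ∀ y ∈ Set.Ioo (0 : ℝ) 1, ∀ z ∈ Set.Ioo (0 : ℝ) 1,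
      F 0 x * F 1 y * F 2 z = K * ((x ^ (p + r - 1) * (1 - x) ^ (q + r - 1)) *
        (y ^ (p - 1) * (1 - y) ^ (q + r - 1)) * (z ^ (r - 1) * (1 - z) ^ (q - 1))))
    (hμ : μ = (volume.restrict cube).withDensity fun y => ENNReal.ofReal (f y)) :
    0 < p ∧ 0 < q ∧ 0 < r ∧ μ = betaProduct p q r := by
  obtain ⟨h, e⟩ := eq_pi_betaMeasure (a := ![p + r, p, r]) (b := ![q + r, q + r, q]) hK
    (fun y hy => by
      rw [hF y hy, hform _ (hy 0) _ (hy 1) _ (hy 2), Fin.prod_univ_three]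
      rfl) hμ
  refine ⟨(h 1).1, (h 2).2, (h 2).1, ?_⟩
  rw [e, betaProduct]
  congr 1
  funext i
  fin_cases i <;> rfl

end BetaIndependence

open BetaIndependence

theorem theorem2 {Ω : Type*} [MeasurableSpace Ω] (P : Measure Ω) [IsProbabilityMeasure P]
    (Y Z : Ω → Fin 3 → ℝ) (hY : Measurable Y)
    (hYcube : ∀ ω, Y ω ∈ BetaIndependence.cube)
    (hYindep : iIndepFun (fun (i : Fin 3) (ω : Ω) => Y ω i) P)
    (f : (Fin 3 → ℝ) → ℝ)
    (hfC1 : ContDiffOn ℝ 1 f BetaIndependence.cube)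
    (hfpos : ∀ y ∈ BetaIndependence.cube, 0 < f y)
    (hYdensity : P.map Y =
      (volume.restrict BetaIndependence.cube).withDensity (fun y => ENNReal.ofReal (f y)))
    (hZ : ∀ ω, Z ω = BetaIndependence.Psi (Y ω))
    (hZindep : iIndepFun (fun (i : Fin 3) (ω : Ω) => Z ω i) P) :
    ∃ p q r : ℝ, 0 < p ∧ 0 < q ∧ 0 < r ∧
      IdentDistrib Y Z P P ∧
      HasLaw Z (BetaIndependence.betaProduct p q r) P := by
  have hZ' : Z = psiFormula ∘ Y := by
    funext ω
    rw [hZ ω, Psi_apply (hYcube ω)]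
    rfl
  have hZm : Measurable Z := hZ' ▸ measurable_psiFormula.comp hY
  have hYi : ∀ i, Measurable fun ω => Y ω i := fun i => (measurable_pi_apply i).comp hY
  have hZi : ∀ i, Measurable fun ω => Z ω i := fun i => (measurable_pi_apply i).comp hZm
  have hYP : ∀ i, IsProbabilityMeasure (P.map fun ω => Y ω i) := fun i =>
    Measure.isProbabilityMeasure_map (hYi i).aemeasurable
  have hZP : ∀ i, IsProbabilityMeasure (P.map fun ω => Z ω i) := fun i =>
    Measure.isProbabilityMeasure_map (hZi i).aemeasurable
  have hYP' : IsProbabilityMeasure (P.map Y) := Measure.isProbabilityMeasure_map hY.aemeasurable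
  have hZP' : IsProbabilityMeasure (P.map Z) := Measure.isProbabilityMeasure_map hZm.aemeasurable
  have hZdensity : P.map Z = (volume.restrict cube).withDensity
      fun z => ENNReal.ofReal (f (psiFormula z) * psiJacobian z) := by
    rw [hZ', ← Measure.map_map measurable_psiFormula hY, hYdensity,
      map_psiFormula_withDensity hfpos]
  have hfd : ∀ y ∈ cube, DifferentiableAt ℝ f y := fun y hy =>
    (hfC1.contDiffAt (isOpen_cube.mem_nhds hy)).differentiableAt one_ne_zero
  have hgd : ∀ z ∈ cube, DifferentiableAt ℝ (fun z => f (psiFormula z) * psiJacobian z) z := by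
    intro z hz
    obtain ⟨A, hA, -⟩ := exists_hasFDerivAt_psiFormula hz
    exact (DifferentiableAt.comp z (hfd _ (psiFormula_mem_and_involutive hz).1)
      hA.differentiableAt).mul (differentiableAt_psiJacobian hz)
  have hgpos : ∀ z ∈ cube, 0 < f (psiFormula z) * psiJacobian z := fun z hz =>
    mul_pos (hfpos _ (psiFormula_mem_and_involutive hz).1) (psiJacobian_pos hz)
  obtain ⟨F, hFpos, hFd, hF⟩ := exists_slices hfd hfpos
    ((hYindep.map_fun_eq_pi_map fun i => (hYi i).aemeasurable).symm.trans hYdensity)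
  obtain ⟨G, hGpos, hGd, hG⟩ := exists_slices hgd hgpos
    ((hZindep.map_fun_eq_pi_map fun i => (hZi i).aemeasurable).symm.trans hZdensity)
  obtain ⟨p, q, r, K, L, hK, hL, hFform, hGform⟩ := exists_beta_form (hFpos 0) (hFpos 1) (hFpos 2)
    (hGpos 0) (hGpos 1) (hGpos 2) (hFd 1) (hFd 2) (hGd 1) (hGd 2) (by
      intro x hx y hy w hw0 hw1 hw2
      obtain ⟨m1, m2, e, eJ⟩ := psiFormula_coordinates hx hy hw0 hw1 hw2
      obtain ⟨-, hxw, -⟩ := domain_facts hx hy hw1 hw2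
      have hx1 : 0 < 1 - x := by linarith [hx.2]
      have qF := hF _ m1
      have qG := hG _ m2
      simp only [e, eJ] at qG
      simp only [Matrix.cons_val_zero, Matrix.cons_val_one, Matrix.cons_val] at qF qG
      rw [← qF, ← qG]
      field_simp)
  obtain ⟨hp, hq, hr, eY⟩ := law_eq_betaProduct hK hF hFform hYdensity
  obtain ⟨-, -, -, eZ⟩ := law_eq_betaProduct hL hG hGform hZdensity
  exact ⟨p, q, r, hp, hq, hr, ⟨hY.aemeasurable, hZm.aemeasurable, eY.trans eZ.symm⟩,
    ⟨hZm.aemeasurable, eZ⟩⟩
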